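/- Let $d\ge 1$ and let $\mathcal H=\mathbb C^d$. A POVM on a finite-dimensional Hilbert space is a finite family $\mathscr A=\{A_j\}_j$ of positive semidefinite operators with $\sum_j A_j=1$; it is simple if its elements are pairwise linearly independent (no element is proportional to another one). Write $\mathscr A\otimes\mathscr A=\{A_j\otimes A_k\}_{j,k}$. For a POVM $\mathscr M=\{M_j\}_j$ on $\mathcal H\otimes\mathcal H$, the two-copy estimation fidelity is $$F(\mathscr M)=\sup_{\{\hat\rho_j\}}\ \sum_j\int \operatorname{tr}(\rho^{\otimes 2}M_j)\,\operatorname{tr}(\rho\hat\rho_j)\,\mathrm d\mu(\psi),\qquad \rho=|\psi\rangle\langle\psi|,$$ where $\mu$ is the normalized unitarily invariant (Haar) measure on pure states of $\mathcal H$ and the supremum (a maximum) runs over all families of density operators $\hat\rho_j$ on $\mathcal H$, one for each outcome $j$. A SIC is a POVM with exactly $d^2$ elements $A_j=\tfrac1d|\psi_j\rangle\langle\psi_j|$, where the $\psi_j$ are unit vectors with $|\langle\psi_j|\psi_k\rangle|^2=\tfrac1{d+1}$ for all $j\ne k$. Put $$F_2^{\mathrm{iid}}=\frac{2\left[d^2+d+1+(d-1)\sqrt{d+1}\right]}{d(d+1)(d+2)}.$$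 **Corollary.** Every POVM $\mathscr A$ on $\mathcal H$, of any rank and with any number of outcomes, satisfies $F(\mathscr A\otimes\mathscr A)\le F_2^{\mathrm{iid}}$. If $\mathscr A$ is simple, then $F(\mathscr A\otimes\mathscr A)=F_2^{\mathrm{iid}}$ if and only if $\mathscr A$ is a SIC. -/

import Mathlib

open MeasureTheory
open scoped Kronecker ComplexOrder

noncomputable section

/-- A POVM with (finitely many) outcomes labelled by `ι` on the Hilbert space with orthonormal
basis labelled by `n`, operators being written as matrices: a family of positive semidefinite
operators that sum up to the identity. -/
structure POVM (n ι : Type*) [Fintype n] [DecidableEq n] [Fintype ι] where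
  /-- the POVM elements -/
  elem : ι → Matrix n n ℂ
  posSemidef : ∀ j, (elem j).PosSemidef
  sum_eq_one : ∑ j, elem j = 1

/-- The tensor product of two POVMs, with elements `A_j ⊗ B_k`. -/
def POVM.tensor {n m ι κ : Type*} [Fintype n] [DecidableEq n] [Fintype m] [DecidableEq m]
    [Fintype ι] [Fintype κ] (A : POVM n ι) (B : POVM m κ) : POVM (n × m) (ι × κ) where
  elem p := A.elem p.1 ⊗ₖ B.elem p.2
  posSemidef p := (A.posSemidef p.1).kronecker (B.posSemidef p.2)
  sum_eq_one := by
    rw [← Matrix.one_kronecker_one, ← A.sum_eq_one, ← B.sum_eq_one, Fintype.sum_prod_type]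
    ext i j
    simp [Matrix.sum_apply, Matrix.kroneckerMap_apply, Finset.sum_mul_sum]

/-- A POVM is simple if its elements are pairwise linearly independent, that is, no element is
proportional to another one. -/
def POVM.IsSimple {n ι : Type*} [Fintype n] [DecidableEq n] [Fintype ι] (A : POVM n ι) : Prop :=
  ∀ j k, j ≠ k → LinearIndependent ℂ ![A.elem j, A.elem k]

/-- The operator `|ψ⟩⟨ψ|` on `ℂ^d`. -/
def ketbra {d : ℕ} (ψ : EuclideanSpace ℂ (Fin d)) : Matrix (Fin d) (Fin d) ℂ :=
  Matrix.vecMulVec (fun i => ψ i) (fun i => star (ψ i))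

/-- A SIC: the POVM has `d ^ 2` elements `(1 / d) |ψ_j⟩⟨ψ_j|`, for unit vectors `ψ_j` with
`|⟨ψ_j, ψ_k⟩|² = 1 / (d + 1)` whenever `j ≠ k`. -/
def POVM.IsSIC {d : ℕ} {ι : Type*} [Fintype ι] (A : POVM (Fin d) ι) : Prop :=
  Fintype.card ι = d ^ 2 ∧
  ∃ ψ : ι → EuclideanSpace ℂ (Fin d),
    (∀ j, ‖ψ j‖ = 1) ∧
    (∀ j k, j ≠ k → ‖inner ℂ (ψ j) (ψ k)‖ ^ 2 = 1 / ((d : ℝ) + 1)) ∧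
    ∀ j, A.elem j = (1 / (d : ℂ)) • ketbra (ψ j)

/-- Density operators on `ℂ^d`. -/
def IsDensityOperator {d : ℕ} (σ : Matrix (Fin d) (Fin d) ℂ) : Prop :=
  σ.PosSemidef ∧ σ.trace = 1

/-- The distribution of a Haar random pure state, as the unitarily invariant probability measure
on unit vectors of `ℂ^d` (normalized surface measure of the unit sphere). All functions
integrated against it below depend on the vector `ψ` only through `|ψ⟩⟨ψ|`. -/
def haarPureState (d : ℕ) : Measure (Metric.sphere (0 : EuclideanSpace ℂ (Fin d)) 1) :=
  ((volume : Measure (EuclideanSpace ℂ (Fin d))).toSphere Set.univ)⁻¹ •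
    (volume : Measure (EuclideanSpace ℂ (Fin d))).toSphere

/-- The average fidelity, in estimating a Haar random pure state `ρ` on `ℂ^d`, of the two-copy
measurement `M` on `ρ ⊗ ρ` together with the estimators `est`: the outcome `j` has
probability `tr ((ρ ⊗ ρ) M_j)` and contributes the fidelity `tr (ρ est_j)`. -/
def averageFidelity {d : ℕ} {κ : Type*} [Fintype κ] (M : POVM (Fin d × Fin d) κ)
    (est : κ → Matrix (Fin d) (Fin d) ℂ) : ℝ :=
  ∑ j, ∫ ψ : Metric.sphere (0 : EuclideanSpace ℂ (Fin d)) 1,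
    ((ketbra ψ.1 ⊗ₖ ketbra ψ.1) * M.elem j).trace.re * (ketbra ψ.1 * est j).trace.re
      ∂(haarPureState d)

/-- The two-copy estimation fidelity of a POVM on `ℂ^d ⊗ ℂ^d`: the maximal average fidelity over
all choices of a density operator as the estimator for each outcome. -/
def estimationFidelity {d : ℕ} {κ : Type*} [Fintype κ] (M : POVM (Fin d × Fin d) κ) : ℝ :=
  sSup {f : ℝ | ∃ est : κ → Matrix (Fin d) (Fin d) ℂ,
    (∀ j, IsDensityOperator (est j)) ∧ f = averageFidelity M est}

/-- The constant `F_2^iid`. -/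
def F2iid (d : ℕ) : ℝ :=
  2 * ((d : ℝ) ^ 2 + d + 1 + ((d : ℝ) - 1) * Real.sqrt ((d : ℝ) + 1)) /
    ((d : ℝ) * ((d : ℝ) + 1) * ((d : ℝ) + 2))

end

/-! Spectral decomposition refines `A` to weights `w k ≥ 0` and unit vectors `x k` whose weighted
projectors sum to the identity. By `integral_haarPureState`, an outcome pair with vectors `x, y` and
a pure estimator `z` contributes the permanent of the Gram matrix of `x, y, z`, up to the factor `d
(d + 1) (d + 2)`. Its maximum over `z` is `2 (1 + t + t ^ 2)` with `t = |⟨x, y⟩|` (`gramPerm_le`,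
`exists_gramPerm_eq`). The weighted sums of `1` and `t ^ 2` over all pairs are fixed by the
resolution of the identity, so everything reduces to bounding the weighted sum of `t`.

Put `s = 1 / √(d + 1)`. The quartic `overlapSlack s t` is nonnegative on `[0, 1]`, has no cubic
term, and has negative coefficients at `t` and `t ^ 4`. Since the sum of `t ^ 4` is at least its
value for a 2-design (`le_frame_potential`), the sum of `t` is at most `1 + (d - 1) / s`, which
yields `F2iid`.

Equality forces `t = s` or `t = 1` for every pair of positive weight. Orthogonal eigenvectors of one
element would have `t = 0`, so each element has rank one; simplicity excludes `t = 1` between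
distinct elements. What remains is an equiangular resolution of the identity, which is a SIC
(`isSIC_of_equiangular`). -/

open scoped Pointwise

/-! ### Third moments of Haar random pure states -/

noncomputable section Moments

variable {d : ℕ}

local notation "𝔼" => EuclideanSpace ℂ (Fin d)
local notation "⟪" x ", " y "⟫" => inner ℂ x y

/-- The action of a unitary on the unit sphere. -/
def sphereMap (U : 𝔼 ≃ₗᵢ[ℂ] 𝔼) (ψ : Metric.sphere (0 : 𝔼) 1) : Metric.sphere (0 : 𝔼) 1 :=
  ⟨U ψ.1, by simp⟩

lemma continuous_sphereMap (U : 𝔼 ≃ₗᵢ[ℂ] 𝔼) : Continuous (sphereMap U) :=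
  (U.continuous.comp continuous_subtype_val).subtype_mk _

/-- The surface measure of a set is, up to a constant, the volume of the cone over it, and a unitary
is a real linear isometry that carries cones to cones. -/
lemma map_toSphere_sphereMap (U : 𝔼 ≃ₗᵢ[ℂ] 𝔼) :
    (volume : Measure 𝔼).toSphere.map (sphereMap U) = (volume : Measure 𝔼).toSphere := by
  have hU := (continuous_sphereMap U).measurable
  let V : 𝔼 ≃ₗᵢ[ℝ] 𝔼 := ⟨U.toLinearEquiv.restrictScalars ℝ, U.norm_map⟩
  have hV : MeasurePreserving V := V.measurePreserving
  ext s hs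
  rw [Measure.map_apply hU hs, Measure.toSphere_apply' _ hs, Measure.toSphere_apply' _ (hU hs)]
  congr 1
  have hset : Set.Ioo (0 : ℝ) 1 • (Subtype.val '' (sphereMap U ⁻¹' s)) =
      V ⁻¹' (Set.Ioo (0 : ℝ) 1 • (Subtype.val '' s)) := by
    ext v
    simp only [Set.mem_smul, Set.mem_image, Set.mem_preimage, exists_exists_and_eq_and]
    constructor
    · rintro ⟨r, hr, ψ, hψ, rfl⟩
      exact ⟨r, hr, sphereMap U ψ, hψ, (map_smul V r ψ.1).symm⟩
    · rintro ⟨r, hr, ψ, hψ, h⟩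
      refine ⟨r, hr, sphereMap U.symm ψ, ?_, ?_⟩
      · convert hψ
        ext1
        exact U.apply_symm_apply ψ.1
      · apply V.injective
        rw [← h, map_smul]
        exact congrArg (r • ·) (U.apply_symm_apply ψ.1)
  rw [hset]
  exact hV.measure_preimage_emb V.toHomeomorph.measurableEmbedding _

lemma isProbabilityMeasure_haarPureState (hd : 1 ≤ d) :
    IsProbabilityMeasure (haarPureState d) := by
  have : Nonempty (Fin d) := ⟨⟨0, hd⟩⟩
  have h : (volume : Measure 𝔼).toSphere Set.univ ≠ 0 := by
    rw [Ne, Measure.measure_univ_eq_zero]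
    exact Measure.toSphere_ne_zero _
  have h' : (volume : Measure 𝔼).toSphere Set.univ ≠ ⊤ := measure_ne_top _ _
  constructor
  rw [haarPureState, Measure.smul_apply, smul_eq_mul, ENNReal.inv_mul_cancel h h']

lemma integral_comp_unitary (U : 𝔼 ≃ₗᵢ[ℂ] 𝔼) {f : 𝔼 → ℝ} (hf : Continuous f) :
    ∫ ψ : Metric.sphere (0 : 𝔼) 1, f (U ψ.1) ∂haarPureState d =
      ∫ ψ : Metric.sphere (0 : 𝔼) 1, f ψ.1 ∂haarPureState d := by
  have h : (haarPureState d).map (sphereMap U) = haarPureState d := by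
    rw [haarPureState, Measure.map_smul, map_toSphere_sphereMap]
  conv_rhs => rw [← h]
  rw [integral_map (continuous_sphereMap U).measurable.aemeasurable
    (f := fun ψ => f ψ.1) (hf.comp continuous_subtype_val).aestronglyMeasurable]
  rfl

lemma integrable_haarPureState {f : 𝔼 → ℝ} (hf : Continuous f) :
    Integrable (fun ψ : Metric.sphere (0 : 𝔼) 1 => f ψ.1) (haarPureState d) :=
  have : IsFiniteMeasure (haarPureState d) := by
    obtain _ | n := d
    -- For `d = 0` the surface measure vanishes, so the infinite normalizing factor does no harm.
    · have : (volume : Measure (EuclideanSpace ℂ (Fin 0))).toSphere = 0 := by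
        rw [Measure.toSphere_eq_zero_iff]; infer_instance
      rw [haarPureState, this, smul_zero]
      infer_instance
    · have := isProbabilityMeasure_haarPureState (Nat.succ_pos n)
      infer_instance
  (hf.comp continuous_subtype_val).integrable_of_hasCompactSupport (.of_compactSpace _)

/-- The unitary group acts transitively on unit vectors. -/
lemma exists_unitary_map {x y : 𝔼} (hx : ‖x‖ = 1) (hy : ‖y‖ = 1) :
    ∃ U : 𝔼 ≃ₗᵢ[ℂ] 𝔼, U x = y := by
  have key : ∀ x : 𝔼, ‖x‖ = 1 → ∀ i : Fin d, ∃ b : OrthonormalBasis (Fin d) ℂ 𝔼, b i = x := by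
    intro x hx i
    have : Orthonormal ℂ (Set.domRestrict {i} (fun _ => x)) := by
      constructor
      · intro j; simpa using hx
      · intro j k hjk; exact absurd (Subsingleton.elim j k) hjk
    obtain ⟨b, hb⟩ := this.exists_orthonormalBasis_extension_of_card_eq (ι := Fin d) (by simp)
    exact ⟨b, hb i rfl⟩
  obtain _ | n := d
  · have : x = 0 := Subsingleton.elim _ _
    simp [this] at hx
  · obtain ⟨b, hb⟩ := key x hx 0
    obtain ⟨b', hb'⟩ := key y hy 0
    refine ⟨b.equiv b' (Equiv.refl _), ?_⟩
    rw [← hb, ← hb']; simp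

/-- The sixth absolute moment of the component of a Haar random vector along a fixed one. -/
lemma exists_moment_eq (d : ℕ) : ∃ c : ℝ, ∀ x : EuclideanSpace ℂ (Fin d),
    ∫ ψ : Metric.sphere (0 : EuclideanSpace ℂ (Fin d)) 1, (‖⟪ψ.1, x⟫‖ ^ 2) ^ 3 ∂haarPureState d =
      c * (‖x‖ ^ 2) ^ 3 := by
  by_cases h : ∃ e : EuclideanSpace ℂ (Fin d), ‖e‖ = 1
  · obtain ⟨e, he⟩ := h
    refine ⟨∫ ψ : Metric.sphere (0 : EuclideanSpace ℂ (Fin d)) 1,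
      (‖⟪ψ.1, e⟫‖ ^ 2) ^ 3 ∂haarPureState d, fun x => ?_⟩
    by_cases hx : x = 0
    · simp [hx]
    have hx' : ‖x‖ ≠ 0 := by simpa using hx
    obtain ⟨U, hU⟩ := exists_unitary_map (x := ((‖x‖⁻¹ : ℝ) : ℂ) • x) (y := e)
      (by rw [norm_smul]; simp [hx']) he
    have hxe : x = ((‖x‖ : ℝ) : ℂ) • U.symm e := by
      rw [← hU, LinearIsometryEquiv.symm_apply_apply, smul_smul, ← Complex.ofReal_mul,
        mul_inv_cancel₀ hx']
      simp
    have h1 : ∀ ψ : EuclideanSpace ℂ (Fin d),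
        (‖⟪ψ, x⟫‖ ^ 2) ^ 3 = (‖x‖ ^ 2) ^ 3 * (‖⟪U ψ, e⟫‖ ^ 2) ^ 3 := by
      intro ψ
      conv_lhs => rw [hxe]
      rw [inner_smul_right, norm_mul, ← U.inner_map_map, U.apply_symm_apply]
      simp [mul_pow]
    simp_rw [h1]
    rw [integral_const_mul, mul_comm,
      integral_comp_unitary U (f := fun ψ => (‖⟪ψ, e⟫‖ ^ 2) ^ 3) (by fun_prop)]
  · refine ⟨0, fun x => ?_⟩
    have : x = 0 := by
      by_contra hx
      exact h ⟨((‖x‖⁻¹ : ℝ) : ℂ) • x, by rw [norm_smul]; simp [hx]⟩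
    simp [this]

/-- The permanent of the Gram matrix of three vectors. -/
def gramPerm {E : Type*} [NormedAddCommGroup E] [InnerProductSpace ℂ E] (x y z : E) : ℝ :=
  ‖x‖ ^ 2 * ‖y‖ ^ 2 * ‖z‖ ^ 2 + ‖x‖ ^ 2 * ‖⟪y, z⟫‖ ^ 2 + ‖y‖ ^ 2 * ‖⟪x, z⟫‖ ^ 2 +
    ‖z‖ ^ 2 * ‖⟪x, y⟫‖ ^ 2 + 2 * (⟪x, y⟫ * ⟪y, z⟫ * ⟪z, x⟫).re

/-- A combination of sixth powers of norms that equals six times the permanent of the Gram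
matrix. -/
def normCombination {E : Type*} [NormedAddCommGroup E] [InnerProductSpace ℂ E] (x y z : E) : ℝ :=
  (1 / 16) * ∑ k : Fin 4, ∑ l : Fin 4,
      (‖x + Complex.I ^ (k : ℕ) • y + Complex.I ^ (l : ℕ) • z‖ ^ 2) ^ 3
    - (1 / 4) * ∑ k : Fin 4, (‖x + Complex.I ^ (k : ℕ) • y‖ ^ 2) ^ 3
    - (1 / 4) * ∑ k : Fin 4, (‖x + Complex.I ^ (k : ℕ) • z‖ ^ 2) ^ 3
    - (1 / 4) * ∑ k : Fin 4, (‖y + Complex.I ^ (k : ℕ) • z‖ ^ 2) ^ 3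
    + (‖x‖ ^ 2) ^ 3 + (‖y‖ ^ 2) ^ 3 + (‖z‖ ^ 2) ^ 3

lemma norm_sq_add_smul_pow {E : Type*} [NormedAddCommGroup E] [InnerProductSpace ℂ E]
    (x y : E) : ∀ k : Fin 4, ‖x + Complex.I ^ (k : ℕ) • y‖ ^ 2 =
      ‖x‖ ^ 2 + ‖y‖ ^ 2 + 2 * (Complex.I ^ (k : ℕ) * ⟪x, y⟫).re := by
  intro k
  rw [norm_add_sq (𝕜 := ℂ), inner_smul_right, norm_smul]
  simp
  ring

/-- Polarization: phases occur with degree at most three, so averaging over fourth roots of unity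
removes every phase-dependent term. Inclusion-exclusion then keeps only the terms that involve all
three vectors. -/
lemma normCombination_eq {E : Type*} [NormedAddCommGroup E] [InnerProductSpace ℂ E] (x y z : E) :
    normCombination x y z = 6 * gramPerm x y z := by
  have h : ∀ k l : Fin 4, ‖x + Complex.I ^ (k : ℕ) • y + Complex.I ^ (l : ℕ) • z‖ ^ 2 =
      ‖x‖ ^ 2 + ‖y‖ ^ 2 + ‖z‖ ^ 2 + 2 * (Complex.I ^ (k : ℕ) * ⟪x, y⟫).re
        + 2 * (Complex.I ^ (l : ℕ) * ⟪x, z⟫).re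
        + 2 * (star (Complex.I ^ (k : ℕ)) * Complex.I ^ (l : ℕ) * ⟪y, z⟫).re := by
    intro k l
    rw [norm_add_sq (𝕜 := ℂ), norm_sq_add_smul_pow, inner_smul_right, inner_add_left,
      inner_smul_left, norm_smul]
    simp [mul_add]
    ring
  have hI : Complex.I ^ 3 = -Complex.I := by rw [pow_succ, Complex.I_sq]; ring
  unfold normCombination gramPerm
  simp_rw [h, norm_sq_add_smul_pow]
  rw [← inner_conj_symm z x]
  generalize ‖x‖ ^ 2 = X
  generalize ‖y‖ ^ 2 = Y
  generalize ‖z‖ ^ 2 = Z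
  generalize ⟪x, y⟫ = a
  generalize ⟪x, z⟫ = b
  generalize ⟪y, z⟫ = c
  rw [Complex.sq_norm, Complex.sq_norm, Complex.sq_norm]
  simp only [Complex.normSq_apply, Fin.sum_univ_four]
  simp [hI]
  ring

lemma gramPerm_complex (u v w : ℂ) :
    gramPerm u v w = 6 * (‖u‖ ^ 2 * ‖v‖ ^ 2 * ‖w‖ ^ 2) := by
  unfold gramPerm
  simp only [Complex.sq_norm, Complex.normSq_apply]
  simp
  ring

/-- The same polarization identity is used twice: for the scalars `⟪ψ, x⟫`, `⟪ψ, y⟫`, `⟪ψ, z⟫` it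
produces 36 times the integrand, and for the vectors it evaluates the integral, which is linear in
the sixth powers. -/
lemma integral_eq_of_moment {c : ℝ}
    (hc : ∀ x : 𝔼, ∫ ψ : Metric.sphere (0 : 𝔼) 1, (‖⟪ψ.1, x⟫‖ ^ 2) ^ 3 ∂haarPureState d =
      c * (‖x‖ ^ 2) ^ 3) (x y z : 𝔼) :
    ∫ ψ : Metric.sphere (0 : 𝔼) 1,
      ‖⟪ψ.1, x⟫‖ ^ 2 * ‖⟪ψ.1, y⟫‖ ^ 2 * ‖⟪ψ.1, z⟫‖ ^ 2 ∂haarPureState d =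
      c / 6 * gramPerm x y z := by
  let P (f : Metric.sphere (0 : 𝔼) 1 → ℝ) (v : ℝ) : Prop :=
    Integrable f (haarPureState d) ∧ ∫ ψ, f ψ ∂haarPureState d = c * v
  have base : ∀ x : 𝔼, P (fun ψ => (‖⟪ψ.1, x⟫‖ ^ 2) ^ 3) ((‖x‖ ^ 2) ^ 3) := fun x =>
    ⟨integrable_haarPureState (f := fun ψ => (‖⟪ψ, x⟫‖ ^ 2) ^ 3) (by fun_prop), hc x⟩
  have add : ∀ {f g v w}, P f v → P g w → P (fun ψ => f ψ + g ψ) (v + w) := fun hf hg =>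
    ⟨hf.1.add hg.1, by rw [integral_add hf.1 hg.1, hf.2, hg.2, mul_add]⟩
  have sub : ∀ {f g v w}, P f v → P g w → P (fun ψ => f ψ - g ψ) (v - w) := fun hf hg =>
    ⟨hf.1.sub hg.1, by rw [integral_sub hf.1 hg.1, hf.2, hg.2, mul_sub]⟩
  have smul : ∀ (r : ℝ) {f v}, P f v → P (fun ψ => r * f ψ) (r * v) := fun r _ _ hf =>
    ⟨hf.1.const_mul r, by rw [integral_const_mul, hf.2]; ring⟩
  have sum : ∀ {f : Fin 4 → Metric.sphere (0 : 𝔼) 1 → ℝ} {v : Fin 4 → ℝ}, (∀ k, P (f k) (v k)) →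
      P (fun ψ => ∑ k, f k ψ) (∑ k, v k) := fun hf =>
    ⟨integrable_finsetSum _ fun k _ => (hf k).1, by
      rw [integral_finsetSum _ fun k _ => (hf k).1, Finset.mul_sum]
      exact Finset.sum_congr rfl fun k _ => (hf k).2⟩
  have h1 : ∀ ψ : Metric.sphere (0 : 𝔼) 1,
      ‖⟪ψ.1, x⟫‖ ^ 2 * ‖⟪ψ.1, y⟫‖ ^ 2 * ‖⟪ψ.1, z⟫‖ ^ 2 =
        1 / 36 * normCombination ⟪ψ.1, x⟫ ⟪ψ.1, y⟫ ⟪ψ.1, z⟫ := by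
    intro ψ
    rw [normCombination_eq, gramPerm_complex]
    ring
  have h2 : ∫ ψ : Metric.sphere (0 : 𝔼) 1,
      normCombination ⟪ψ.1, x⟫ ⟪ψ.1, y⟫ ⟪ψ.1, z⟫ ∂haarPureState d = c * normCombination x y z := by
    unfold normCombination
    -- Each combination of components becomes the component along a single vector, so the sixth
    -- moment applies termwise.
    simp only [smul_eq_mul, ← inner_smul_right, ← inner_add_right]
    exact (add (add (add (sub (sub (sub (smul _ (sum fun k => sum fun l => base _))
      (smul _ (sum fun k => base _))) (smul _ (sum fun k => base _)))
      (smul _ (sum fun k => base _))) (base x)) (base y)) (base z)).2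
  simp_rw [h1]
  rw [integral_const_mul, h2, normCombination_eq]
  ring

lemma sum_gramPerm_basis (x y : 𝔼) :
    ∑ k, gramPerm x y (EuclideanSpace.basisFun (Fin d) ℂ k) =
      (d + 2) * (‖x‖ ^ 2 * ‖y‖ ^ 2 + ‖⟪x, y⟫‖ ^ 2) := by
  unfold gramPerm
  have h := (EuclideanSpace.basisFun (Fin d) ℂ).sum_inner_mul_inner y x
  simp only [Finset.sum_add_distrib, ← Finset.mul_sum, mul_assoc, ← Complex.re_sum, h,
    OrthonormalBasis.sum_sq_norm_inner_left, OrthonormalBasis.norm_eq_one]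
  rw [← inner_conj_symm y x, Complex.mul_conj, Complex.normSq_eq_norm_sq, Complex.ofReal_re]
  simp
  ring

/-- The third moments of a Haar random pure state. -/
lemma integral_haarPureState (hd : 1 ≤ d) (x y z : 𝔼) :
    ∫ ψ : Metric.sphere (0 : 𝔼) 1,
      ‖⟪ψ.1, x⟫‖ ^ 2 * ‖⟪ψ.1, y⟫‖ ^ 2 * ‖⟪ψ.1, z⟫‖ ^ 2 ∂haarPureState d =
      gramPerm x y z / (d * (d + 1) * (d + 2)) := by
  obtain ⟨c, hc⟩ := exists_moment_eq d
  have hG := integral_eq_of_moment hc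
  have := isProbabilityMeasure_haarPureState hd
  let b := EuclideanSpace.basisFun (Fin d) ℂ
  -- The constant `c` is fixed by summing over all triples of basis vectors, where Parseval turns
  -- the integrand into `1`.
  have h1 : ∑ i, ∑ j, ∑ k, ∫ ψ : Metric.sphere (0 : 𝔼) 1,
      ‖⟪ψ.1, b i⟫‖ ^ 2 * ‖⟪ψ.1, b j⟫‖ ^ 2 * ‖⟪ψ.1, b k⟫‖ ^ 2 ∂haarPureState d = 1 := by
    have hi : ∀ i j k, Integrable (fun ψ : Metric.sphere (0 : 𝔼) 1 =>
        ‖⟪ψ.1, b i⟫‖ ^ 2 * ‖⟪ψ.1, b j⟫‖ ^ 2 * ‖⟪ψ.1, b k⟫‖ ^ 2) (haarPureState d) :=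
      fun i j k => integrable_haarPureState
        (f := fun ψ => ‖⟪ψ, b i⟫‖ ^ 2 * ‖⟪ψ, b j⟫‖ ^ 2 * ‖⟪ψ, b k⟫‖ ^ 2) (by fun_prop)
    simp_rw [← integral_finsetSum _ fun k _ => hi _ _ k]
    simp_rw [← integral_finsetSum _ fun j _ => integrable_finsetSum _ fun k _ => hi _ j k]
    rw [← integral_finsetSum _ fun i _ => integrable_finsetSum _ fun j _ =>
      integrable_finsetSum _ fun k _ => hi i j k]
    simp_rw [← Finset.mul_sum, OrthonormalBasis.sum_sq_norm_inner_left, ← Finset.sum_mul,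
      ← Finset.mul_sum, OrthonormalBasis.sum_sq_norm_inner_left, ← Finset.sum_mul,
      OrthonormalBasis.sum_sq_norm_inner_left]
    have : ∀ ψ : Metric.sphere (0 : 𝔼) 1, ‖ψ.1‖ = 1 := fun ψ => by simp
    simp [this]
  have h2 : c / 6 * (d * (d + 1) * (d + 2)) = 1 := by
    refine Eq.trans ?_ h1
    simp_rw [hG, ← Finset.mul_sum]
    simp_rw [b, sum_gramPerm_basis, OrthonormalBasis.norm_eq_one, ← Finset.mul_sum,
      Finset.sum_add_distrib]
    simp only [OrthonormalBasis.sum_sq_norm_inner_left, OrthonormalBasis.norm_eq_one, one_pow,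
      Finset.sum_const, Finset.card_univ, Fintype.card_fin, nsmul_eq_mul, mul_one]
    ring
  have hne : (d * (d + 1) * (d + 2) : ℝ) ≠ 0 := by positivity
  rw [hG, eq_div_iff hne, mul_right_comm, h2, one_mul]

end Moments

/-! ### Optimal estimator for a pair of vectors -/

section GramPerm

variable {E : Type*} [NormedAddCommGroup E] [InnerProductSpace ℂ E]

local notation "⟪" x ", " y "⟫" => inner ℂ x y

/-- The permanent is at most `1 + t² + p² + q² + 2tpq ≤ 1 + t² + (1 + t)(p² + q²)`, and `p² + q² ≤ 1
+ t` because `1 + t` bounds the operator `|x⟩⟨x| + |y⟩⟨y|`. -/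
lemma gramPerm_le {x y z : E} (hx : ‖x‖ = 1) (hy : ‖y‖ = 1) (hz : ‖z‖ = 1) :
    gramPerm x y z ≤ 2 * (1 + ‖⟪x, y⟫‖ + ‖⟪x, y⟫‖ ^ 2) := by
  have hre : (⟪x, y⟫ * ⟪y, z⟫ * ⟪z, x⟫).re ≤ ‖⟪x, y⟫‖ * ‖⟪y, z⟫‖ * ‖⟪x, z⟫‖ := by
    refine (Complex.re_le_norm _).trans_eq ?_
    rw [norm_mul, norm_mul, norm_inner_symm z x]
  set t := ‖⟪x, y⟫‖ with ht
  set p := ‖⟪x, z⟫‖ with hp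
  set q := ‖⟪y, z⟫‖ with hq
  have ht0 : 0 ≤ t := norm_nonneg _
  have hpq : p ^ 2 + q ^ 2 ≤ 1 + t := by
    -- `w` is the image of `z` under `|x⟩⟨x| + |y⟩⟨y|`; Cauchy-Schwarz compares `⟪w, z⟫` with `‖w‖`.
    set w := ⟪x, z⟫ • x + ⟪y, z⟫ • y with hw
    have h1 : ⟪w, z⟫ = ((p ^ 2 + q ^ 2 : ℝ) : ℂ) := by
      rw [hw, inner_add_left, inner_smul_left, inner_smul_left, mul_comm, Complex.mul_conj,
        mul_comm, Complex.mul_conj, Complex.normSq_eq_norm_sq, Complex.normSq_eq_norm_sq]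
      push_cast
      rfl
    have h2 : p ^ 2 + q ^ 2 ≤ ‖w‖ := by
      have := norm_inner_le_norm (𝕜 := ℂ) w z
      rwa [h1, Complex.norm_real, Real.norm_of_nonneg (by positivity), hz, mul_one] at this
    have h3 : ‖w‖ ^ 2 ≤ p ^ 2 + q ^ 2 + 2 * (p * q * t) := by
      rw [hw, norm_add_sq (𝕜 := ℂ), norm_smul, norm_smul, hx, hy, mul_one, mul_one]
      have : RCLike.re ⟪⟪x, z⟫ • x, ⟪y, z⟫ • y⟫ ≤ p * q * t := by
        refine (RCLike.re_le_norm _).trans_eq ?_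
        rw [inner_smul_left, inner_smul_right, norm_mul, norm_mul, RCLike.norm_conj]
        ring
      linarith
    by_contra! h
    nlinarith [mul_nonneg ht0 (sq_nonneg (p - q)), sq_nonneg (p - q)]
  unfold gramPerm
  rw [hx, hy, hz]
  nlinarith [mul_nonneg ht0 (sq_nonneg (p - q))]

/-- The maximizer is the top eigenvector of `|x⟩⟨x| + |y⟩⟨y|`: the normalized sum of `x` and `y`
after the phase `η` has made their inner product nonnegative. -/
lemma exists_gramPerm_eq {x y : E} (hx : ‖x‖ = 1) (hy : ‖y‖ = 1) :
    ∃ z : E, ‖z‖ = 1 ∧ gramPerm x y z = 2 * (1 + ‖⟪x, y⟫‖ + ‖⟪x, y⟫‖ ^ 2) := by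
  obtain ⟨η, hη, hηc⟩ : ∃ η : ℂ, ‖η‖ = 1 ∧ η * ⟪x, y⟫ = (‖⟪x, y⟫‖ : ℂ) := by
    by_cases h : ⟪x, y⟫ = 0
    · exact ⟨1, by simp, by simp [h]⟩
    · have h' : ‖⟪x, y⟫‖ ≠ 0 := by simpa using h
      refine ⟨‖⟪x, y⟫‖ / ⟪x, y⟫, by simp [h'], by field_simp⟩
  set t := ‖⟪x, y⟫‖ with ht
  have ht0 : 0 ≤ t := norm_nonneg _
  have hyx : ⟪y, x⟫ = η * t := by
    rw [← inner_conj_symm, ← hηc]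
    have h1 : η * star η = 1 := by
      rw [Complex.star_def, Complex.mul_conj, Complex.normSq_eq_norm_sq, hη]; simp
    have h2 : star (η * ⟪x, y⟫) = η * ⟪x, y⟫ := by rw [hηc]; simp
    rw [← h2, star_mul', ← mul_assoc, h1, one_mul]
    rfl
  have hxy : ⟪x, y⟫ = star η * t := by
    rw [← inner_conj_symm, hyx]; simp
  have hηη : star η * η = 1 := by
    rw [mul_comm, Complex.star_def, Complex.mul_conj, Complex.normSq_eq_norm_sq, hη]; simp
  set v := x + η • y with hv
  have hxv : ⟪x, v⟫ = ((1 + t : ℝ) : ℂ) := by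
    rw [hv, inner_add_right, inner_smul_right, hηc, inner_self_eq_norm_sq_to_K, hx]; simp
  have hyv : ⟪y, v⟫ = η * ((1 + t : ℝ) : ℂ) := by
    rw [hv, inner_add_right, inner_smul_right, inner_self_eq_norm_sq_to_K, hy, hyx]
    push_cast
    simp; ring
  have hvv : ‖v‖ ^ 2 = 2 * (1 + t) := by
    have : ⟪v, v⟫ = ((2 * (1 + t) : ℝ) : ℂ) := by
      conv_lhs => rw [hv, inner_add_left, inner_smul_left, hxv, hyv]
      rw [← mul_assoc, ← Complex.star_def, hηη]
      push_cast; ring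
    rw [← inner_self_eq_norm_sq (𝕜 := ℂ), this]
    exact Complex.ofReal_re _
  have hv0 : ‖v‖ ≠ 0 := by
    intro h; rw [h] at hvv; nlinarith
  refine ⟨((‖v‖⁻¹ : ℝ) : ℂ) • v, by rw [norm_smul]; simp [hv0], ?_⟩
  have hs : (‖v‖⁻¹) ^ 2 * (1 + t) ^ 2 = (1 + t) / 2 := by
    rw [inv_pow, hvv]; field_simp
  have hz : ‖((‖v‖⁻¹ : ℝ) : ℂ) • v‖ = 1 := by rw [norm_smul]; simp [hv0]
  unfold gramPerm
  rw [hx, hy, hz, ← ht, inner_smul_right, inner_smul_right, inner_smul_left, ← inner_conj_symm v x,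
    hxv, hyv, hxy, norm_mul, norm_mul, norm_mul, hη, Complex.norm_real, Complex.norm_real]
  have h4 : (star η * (t : ℂ) * (((‖v‖⁻¹ : ℝ) : ℂ) * (η * ((1 + t : ℝ) : ℂ))) *
      ((starRingEnd ℂ) ((‖v‖⁻¹ : ℝ) : ℂ) * (starRingEnd ℂ) ((1 + t : ℝ) : ℂ))) =
      ((t * ((‖v‖⁻¹) ^ 2 * (1 + t) ^ 2) : ℝ) : ℂ) := by
    rw [Complex.conj_ofReal, Complex.conj_ofReal]
    push_cast
    linear_combination (t * ((‖v‖ : ℂ)⁻¹) ^ 2 * (1 + t) ^ 2 : ℂ) * hηη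
  rw [h4, hs, Complex.ofReal_re]
  simp only [Real.norm_eq_abs, one_mul, mul_pow, sq_abs, hs]
  ring

end GramPerm

/-! ### Traces of rank one projectors -/

section Ketbra

variable {d : ℕ}

local notation "𝔼" => EuclideanSpace ℂ (Fin d)
local notation "⟪" x ", " y "⟫" => inner ℂ x y

lemma trace_ketbra_mul_ketbra (x y : 𝔼) :
    (ketbra x * ketbra y).trace = ((‖⟪x, y⟫‖ ^ 2 : ℝ) : ℂ) := by
  rw [ketbra, ketbra, Matrix.vecMulVec_mul_vecMulVec, Matrix.trace_vecMulVec,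
    ← Complex.normSq_eq_norm_sq, ← Complex.mul_conj, inner_conj_symm, PiLp.inner_apply,
    PiLp.inner_apply]
  simp only [dotProduct, smul_eq_mul, RCLike.inner_apply, Pi.smul_apply, Finset.sum_mul,
    Finset.mul_sum, Complex.star_def]
  refine Finset.sum_congr rfl fun i _ => Finset.sum_congr rfl fun j _ => ?_
  ring

lemma trace_ketbra (x : 𝔼) : (ketbra x).trace = ((‖x‖ ^ 2 : ℝ) : ℂ) := by
  rw [EuclideanSpace.norm_sq_eq, ketbra, Matrix.trace_vecMulVec]
  simp [dotProduct, Complex.mul_conj, Complex.normSq_eq_norm_sq]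

lemma posSemidef_ketbra (x : 𝔼) : (ketbra x).PosSemidef :=
  Matrix.posSemidef_vecMulVec_self_star _

end Ketbra

/-! ### Overlap sums of weighted resolutions of the identity -/

section WeightedFrame

variable {d : ℕ} {κ : Type*} [Fintype κ]

local notation "𝔼" => EuclideanSpace ℂ (Fin d)
local notation "⟪" x ", " y "⟫" => inner ℂ x y

lemma sum_weight_mul_normSq_inner {w : κ → ℝ} {x : κ → 𝔼}
    (h : ∑ k, (w k : ℂ) • ketbra (x k) = 1) (y : 𝔼) :
    ∑ k, w k * ‖⟪y, x k⟫‖ ^ 2 = ‖y‖ ^ 2 := by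
  have := congrArg (fun M => (ketbra y * M).trace) h
  simp only [Finset.mul_sum, Matrix.mul_smul, Matrix.trace_sum, Matrix.trace_smul,
    trace_ketbra_mul_ketbra, mul_one, trace_ketbra, smul_eq_mul] at this
  exact_mod_cast this

lemma sum_weight {w : κ → ℝ} {x : κ → 𝔼} (hx : ∀ k, ‖x k‖ = 1)
    (h : ∑ k, (w k : ℂ) • ketbra (x k) = 1) : ∑ k, w k = d := by
  have := congrArg Matrix.trace h
  simp only [Matrix.trace_sum, Matrix.trace_smul, trace_ketbra, hx, Matrix.trace_one,
    Fintype.card_fin, smul_eq_mul] at this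
  simp at this
  exact_mod_cast this

/-- The operator that exchanges the two tensor factors. -/
def swapMatrix (d : ℕ) : Matrix (Fin d × Fin d) (Fin d × Fin d) ℂ :=
  Matrix.of fun p q => if p = q.swap then 1 else 0

lemma mul_swapMatrix_apply (M : Matrix (Fin d × Fin d) (Fin d × Fin d) ℂ) (p q) :
    (M * swapMatrix d) p q = M p q.swap := by
  simp [Matrix.mul_apply, swapMatrix]

lemma swapMatrix_mul_swapMatrix : swapMatrix d * swapMatrix d = 1 := by
  ext p q
  rw [mul_swapMatrix_apply, swapMatrix, Matrix.of_apply, Prod.swap_swap, Matrix.one_apply]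

lemma conjTranspose_swapMatrix : (swapMatrix d).conjTranspose = swapMatrix d := by
  ext p q
  have : q = p.swap ↔ p = q.swap := by
    constructor <;> (rintro rfl; simp)
  simp [swapMatrix, Matrix.conjTranspose_apply, this, apply_ite]

lemma trace_kronecker_mul_swapMatrix (A B : Matrix (Fin d) (Fin d) ℂ) :
    ((A ⊗ₖ B) * swapMatrix d).trace = (A * B).trace := by
  simp only [Matrix.trace, Matrix.diag, mul_swapMatrix_apply]
  simp only [Matrix.kroneckerMap_apply, Fintype.sum_prod_type, Prod.fst_swap, Prod.snd_swap,
    Matrix.mul_apply]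

lemma trace_swapMatrix : (swapMatrix d).trace = d := by
  have := trace_kronecker_mul_swapMatrix (1 : Matrix (Fin d) (Fin d) ℂ) 1
  simpa using this

/-- The second frame potential is bounded from below by its value for `2`-designs. -/
lemma le_frame_potential {w : κ → ℝ} {x : κ → 𝔼} (hx : ∀ k, ‖x k‖ = 1)
    (h : ∑ k, (w k : ℂ) • ketbra (x k) = 1) :
    2 * (d : ℝ) / (d + 1) ≤ ∑ k, ∑ l, w k * w l * ‖⟪x k, x l⟫‖ ^ 4 := by
  set M : Matrix (Fin d × Fin d) (Fin d × Fin d) ℂ :=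
    ∑ k, (w k : ℂ) • (ketbra (x k) ⊗ₖ ketbra (x k)) with hM
  set S := swapMatrix d
  -- For a 2-design `M` equals `r • (1 + S)`; the bound is the nonnegativity of the squared
  -- Hilbert-Schmidt distance between the two.
  set r : ℂ := ((1 / (d + 1) : ℝ) : ℂ) with hr
  have hMH : M.conjTranspose = M := by
    simp only [hM, Matrix.conjTranspose_sum, Matrix.conjTranspose_smul,
      Matrix.conjTranspose_kronecker, (posSemidef_ketbra _).isHermitian.eq]
    simp
  have hr' : star r = r := by simp [hr]
  have hMM : (M * M).trace = ((∑ k, ∑ l, w k * w l * ‖⟪x k, x l⟫‖ ^ 4 : ℝ) : ℂ) := by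
    rw [hM]
    simp only [Finset.sum_mul, Finset.mul_sum, Matrix.smul_mul, Matrix.mul_smul,
      ← Matrix.mul_kronecker_mul, Matrix.trace_sum, Matrix.trace_smul, Matrix.trace_kronecker,
      trace_ketbra_mul_ketbra]
    push_cast
    refine Finset.sum_congr rfl fun k _ => Finset.sum_congr rfl fun l _ => ?_
    rw [norm_inner_symm (x l)]
    simp only [smul_eq_mul]
    ring
  have hMt : M.trace = d := by
    rw [hM]
    simp only [Matrix.trace_sum, Matrix.trace_smul, Matrix.trace_kronecker, trace_ketbra, hx]
    simpa [hx] using congrArg (fun a : ℝ => (a : ℂ)) (sum_weight hx h)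
  have hMS : (M * S).trace = d := by
    rw [hM]
    simp only [Finset.sum_mul, Matrix.smul_mul, Matrix.trace_sum, Matrix.trace_smul, S,
      trace_kronecker_mul_swapMatrix, trace_ketbra_mul_ketbra]
    have : ∀ k, ‖⟪x k, x k⟫‖ = 1 := fun k => by simp [hx]
    simpa [this, hx] using congrArg (fun a : ℝ => (a : ℂ)) (sum_weight hx h)
  have hpos := (Matrix.posSemidef_conjTranspose_mul_self (M - r • (1 + S))).trace_nonneg
  have hexp : ((M - r • (1 + S)).conjTranspose * (M - r • (1 + S))).trace =
      (M * M).trace - 2 * r * (M.trace + (M * S).trace) + r ^ 2 * (2 * d ^ 2 + 2 * d) := by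
    rw [Matrix.conjTranspose_sub, hMH, Matrix.conjTranspose_smul, hr', Matrix.conjTranspose_add,
      Matrix.conjTranspose_one, conjTranspose_swapMatrix]
    simp only [sub_mul, mul_sub, Matrix.smul_mul, Matrix.mul_smul, mul_add, add_mul, mul_one,
      one_mul, swapMatrix_mul_swapMatrix, Matrix.trace_sub, Matrix.trace_add, Matrix.trace_smul,
      S, trace_swapMatrix, Matrix.trace_mul_comm (swapMatrix d) M, Matrix.trace_one, smul_eq_mul,
      Fintype.card_prod, Fintype.card_fin]
    push_cast
    ring
  rw [hexp, hMM, hMt, hMS, hr] at hpos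
  have hd : (d + 1 : ℝ) ≠ 0 := by positivity
  have key : 0 ≤ (∑ k, ∑ l, w k * w l * ‖⟪x k, x l⟫‖ ^ 4) - 2 * (1 / (d + 1)) * (d + d)
      + (1 / (d + 1)) ^ 2 * (2 * (d : ℝ) ^ 2 + 2 * d) := by exact_mod_cast hpos
  have : 2 * (1 / (d + 1)) * (d + d) - (1 / (d + 1)) ^ 2 * (2 * (d : ℝ) ^ 2 + 2 * d) =
      2 * (d : ℝ) / (d + 1) := by
    field_simp; ring
  linarith

/-- The slack of the polynomial bound on the overlaps: it vanishes, for `0 ≤ t ≤ 1`, only at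
`t = s` and `t = 1`. -/
def overlapSlack (s t : ℝ) : ℝ := (t - s) ^ 2 * (1 - t) * (t + 1 + 2 * s)

lemma overlapSlack_nonneg {s t : ℝ} (hs : 0 ≤ s) (ht : 0 ≤ t) (ht1 : t ≤ 1) :
    0 ≤ overlapSlack s t := by
  have : 0 ≤ 1 - t := by linarith
  unfold overlapSlack
  positivity

lemma sum_weight_mul_weight {w : κ → ℝ} {x : κ → 𝔼} (hx : ∀ k, ‖x k‖ = 1)
    (h : ∑ k, (w k : ℂ) • ketbra (x k) = 1) : ∑ k, ∑ l, w k * w l = (d : ℝ) ^ 2 := by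
  simp_rw [← Finset.mul_sum, ← Finset.sum_mul, sum_weight hx h]; ring

lemma sum_overlap_sq {w : κ → ℝ} {x : κ → 𝔼} (hx : ∀ k, ‖x k‖ = 1)
    (h : ∑ k, (w k : ℂ) • ketbra (x k) = 1) :
    ∑ k, ∑ l, w k * w l * ‖⟪x k, x l⟫‖ ^ 2 = d := by
  simp_rw [mul_assoc, ← Finset.mul_sum, sum_weight_mul_normSq_inner h, hx, one_pow, mul_one]
  exact sum_weight hx h

lemma sum_overlap_quadratic {w : κ → ℝ} {x : κ → 𝔼} (hx : ∀ k, ‖x k‖ = 1)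
    (h : ∑ k, (w k : ℂ) • ketbra (x k) = 1) :
    ∑ k, ∑ l, w k * w l * (2 * (1 + ‖⟪x k, x l⟫‖ + ‖⟪x k, x l⟫‖ ^ 2)) =
      2 * ((d : ℝ) ^ 2 + d + ∑ k, ∑ l, w k * w l * ‖⟪x k, x l⟫‖) := by
  have h2 := sum_overlap_sq hx h
  rw [← sum_weight_mul_weight hx h]
  conv_rhs => enter [2, 1, 2]; rw [← h2]
  simp only [Finset.mul_sum, ← Finset.sum_add_distrib]
  refine Finset.sum_congr rfl fun k _ => Finset.sum_congr rfl fun l _ => ?_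
  ring

/-- Summing `overlapSlack` over all pairs involves only the powers 0, 1, 2, 4 of the overlap. Powers
0 and 2 have known sums, so the deficit in the linear sum is the total slack plus the excess of the
frame potential. -/
lemma sum_overlap_eq {w : κ → ℝ} {x : κ → 𝔼} (hx : ∀ k, ‖x k‖ = 1)
    (h : ∑ k, (w k : ℂ) • ketbra (x k) = 1) {s : ℝ} (hs : 0 < s) (hsd : s ^ 2 * (d + 1) = 1) :
    2 * s * (1 + s) ^ 2 * (1 + (d - 1) / s - ∑ k, ∑ l, w k * w l * ‖⟪x k, x l⟫‖) =
      (∑ k, ∑ l, w k * w l * overlapSlack s ‖⟪x k, x l⟫‖) +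
      ((∑ k, ∑ l, w k * w l * ‖⟪x k, x l⟫‖ ^ 4) - 2 * (d : ℝ) / (d + 1)) := by
  have hexp : ∑ k, ∑ l, w k * w l * overlapSlack s ‖⟪x k, x l⟫‖ =
      -(∑ k, ∑ l, w k * w l * ‖⟪x k, x l⟫‖ ^ 4)
      + (1 + 2 * s + 3 * s ^ 2) * (∑ k, ∑ l, w k * w l * ‖⟪x k, x l⟫‖ ^ 2)
      - 2 * s * (1 + s) ^ 2 * (∑ k, ∑ l, w k * w l * ‖⟪x k, x l⟫‖)
      + s ^ 2 * (1 + 2 * s) * ∑ k, ∑ l, w k * w l := by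
    simp only [Finset.mul_sum, ← Finset.sum_neg_distrib, ← Finset.sum_add_distrib,
      ← Finset.sum_sub_distrib]
    refine Finset.sum_congr rfl fun k _ => Finset.sum_congr rfl fun l _ => ?_
    unfold overlapSlack
    ring
  rw [hexp, sum_weight_mul_weight hx h, sum_overlap_sq hx h]
  have hd : (d : ℝ) = 1 / s ^ 2 - 1 := by
    field_simp; linarith
  have hd1 : 2 * (d : ℝ) / (d + 1) = 2 * d * s ^ 2 := by
    have : (d + 1 : ℝ) ≠ 0 := by positivity
    rw [div_eq_iff this]; linear_combination (-2 * d : ℝ) * hsd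
  rw [hd1, hd]
  field_simp
  ring

lemma norm_inner_le_one {x y : 𝔼} (hx : ‖x‖ = 1) (hy : ‖y‖ = 1) : ‖⟪x, y⟫‖ ≤ 1 := by
  simpa [hx, hy] using norm_inner_le_norm (𝕜 := ℂ) x y

lemma sum_overlap_le {w : κ → ℝ} {x : κ → 𝔼} (hw : ∀ k, 0 ≤ w k) (hx : ∀ k, ‖x k‖ = 1)
    (h : ∑ k, (w k : ℂ) • ketbra (x k) = 1) {s : ℝ} (hs : 0 < s) (hsd : s ^ 2 * (d + 1) = 1) :
    ∑ k, ∑ l, w k * w l * ‖⟪x k, x l⟫‖ ≤ 1 + (d - 1) / s := by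
  have h1 := sum_overlap_eq hx h hs hsd
  have h2 := le_frame_potential hx h
  have h3 : 0 ≤ ∑ k, ∑ l, w k * w l * overlapSlack s ‖⟪x k, x l⟫‖ :=
    Finset.sum_nonneg fun k _ => Finset.sum_nonneg fun l _ =>
      mul_nonneg (mul_nonneg (hw k) (hw l)) (overlapSlack_nonneg hs.le (norm_nonneg _)
        (norm_inner_le_one (hx k) (hx l)))
  have h4 : 0 < 2 * s * (1 + s) ^ 2 := by positivity
  by_contra! hlt
  have := mul_neg_of_pos_of_neg h4 (sub_neg.mpr hlt)
  linarith

/-- With no deficit, the total slack and the frame excess, both nonnegative, vanish. So the slack of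
each pair of positive weight is zero. -/
lemma overlap_eq_of_sum_overlap_eq {w : κ → ℝ} {x : κ → 𝔼} (hw : ∀ k, 0 ≤ w k)
    (hx : ∀ k, ‖x k‖ = 1) (h : ∑ k, (w k : ℂ) • ketbra (x k) = 1) {s : ℝ} (hs : 0 < s)
    (hsd : s ^ 2 * (d + 1) = 1) (heq : ∑ k, ∑ l, w k * w l * ‖⟪x k, x l⟫‖ = 1 + (d - 1) / s)
    {k l : κ} (hk : 0 < w k) (hl : 0 < w l) : ‖⟪x k, x l⟫‖ = s ∨ ‖⟪x k, x l⟫‖ = 1 := by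
  have h1 := sum_overlap_eq hx h hs hsd
  have h2 := le_frame_potential hx h
  rw [heq, sub_self, mul_zero] at h1
  have hn : ∀ k l, 0 ≤ w k * w l * overlapSlack s ‖⟪x k, x l⟫‖ := fun k l =>
      mul_nonneg (mul_nonneg (hw k) (hw l)) (overlapSlack_nonneg hs.le (norm_nonneg _)
        (norm_inner_le_one (hx k) (hx l)))
  have h3 : w k * w l * overlapSlack s ‖⟪x k, x l⟫‖ ≤ 0 := calc
    _ ≤ ∑ l, w k * w l * overlapSlack s ‖⟪x k, x l⟫‖ :=
      Finset.single_le_sum (f := fun l => w k * w l * overlapSlack s ‖⟪x k, x l⟫‖)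
        (fun l _ => hn k l) (Finset.mem_univ l)
    _ ≤ ∑ k, ∑ l, w k * w l * overlapSlack s ‖⟪x k, x l⟫‖ :=
      Finset.single_le_sum (f := fun k => ∑ l, w k * w l * overlapSlack s ‖⟪x k, x l⟫‖)
        (fun k _ => Finset.sum_nonneg fun l _ => hn k l) (Finset.mem_univ k)
    _ ≤ 0 := by linarith
  have h4 : overlapSlack s ‖⟪x k, x l⟫‖ = 0 := by
    have h5 := le_antisymm h3 (hn k l)
    simpa [hk.ne', hl.ne'] using h5
  have h6 : ‖⟪x k, x l⟫‖ + 1 + 2 * s ≠ 0 := by positivity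
  simp only [overlapSlack, mul_eq_zero, h6, or_false, pow_eq_zero_iff, ne_eq, OfNat.ofNat_ne_zero,
    not_false_eq_true, sub_eq_zero] at h4
  exact h4.imp id Eq.symm

end WeightedFrame

/-! ### From estimation fidelity to overlap sums -/

section Fidelity

variable {d : ℕ}

local notation "𝔼" => EuclideanSpace ℂ (Fin d)
local notation "⟪" x ", " y "⟫" => inner ℂ x y

lemma Matrix.IsHermitian.sum_eigenvalues_smul_ketbra {A : Matrix (Fin d) (Fin d) ℂ}
    (hA : A.IsHermitian) :
    ∑ i, (hA.eigenvalues i : ℂ) • ketbra (hA.eigenvectorBasis i) = A := by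
  conv_rhs => rw [hA.spectral_theorem]
  ext a b
  rw [Unitary.conjStarAlgAut_apply, Matrix.mul_apply, Matrix.sum_apply]
  refine Finset.sum_congr rfl fun i _ => ?_
  rw [Matrix.mul_diagonal]
  simp [ketbra, Matrix.vecMulVec_apply, Matrix.star_apply,
    Matrix.IsHermitian.eigenvectorUnitary_apply]
  ring

lemma trace_ketbra_mul_sum {α : Type*} [Fintype α] (ψ : 𝔼) (a : α → ℝ) (x : α → 𝔼) :
    (ketbra ψ * ∑ i, (a i : ℂ) • ketbra (x i)).trace =
      ((∑ i, a i * ‖⟪ψ, x i⟫‖ ^ 2 : ℝ) : ℂ) := by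
  simp only [Finset.mul_sum, Matrix.mul_smul, Matrix.trace_sum, Matrix.trace_smul,
    trace_ketbra_mul_ketbra, smul_eq_mul]
  push_cast
  rfl

/-- The contribution of an outcome `A ⊗ B` with estimator `C` to the average fidelity. -/
lemma integral_outcome {α β γ : Type*} [Fintype α] [Fintype β] [Fintype γ] (hd : 1 ≤ d)
    (a : α → ℝ) (b : β → ℝ) (c : γ → ℝ) (x : α → 𝔼) (y : β → 𝔼) (z : γ → 𝔼) :
    ∫ ψ : Metric.sphere (0 : 𝔼) 1,
      ((ketbra ψ.1 ⊗ₖ ketbra ψ.1) *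
        ((∑ i, (a i : ℂ) • ketbra (x i)) ⊗ₖ (∑ j, (b j : ℂ) • ketbra (y j)))).trace.re *
        (ketbra ψ.1 * ∑ m, (c m : ℂ) • ketbra (z m)).trace.re ∂haarPureState d =
    ∑ i, ∑ j, a i * b j *
      ∑ m, c m * (gramPerm (x i) (y j) (z m) / (d * (d + 1) * (d + 2))) := by
  have h : ∀ ψ : Metric.sphere (0 : 𝔼) 1, ((ketbra ψ.1 ⊗ₖ ketbra ψ.1) *
        ((∑ i, (a i : ℂ) • ketbra (x i)) ⊗ₖ (∑ j, (b j : ℂ) • ketbra (y j)))).trace.re *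
        (ketbra ψ.1 * ∑ m, (c m : ℂ) • ketbra (z m)).trace.re =
      ∑ i, ∑ j, ∑ m, a i * b j * c m *
        (‖⟪ψ.1, x i⟫‖ ^ 2 * ‖⟪ψ.1, y j⟫‖ ^ 2 * ‖⟪ψ.1, z m⟫‖ ^ 2) := by
    intro ψ
    rw [← Matrix.mul_kronecker_mul, Matrix.trace_kronecker, trace_ketbra_mul_sum,
      trace_ketbra_mul_sum, trace_ketbra_mul_sum, ← Complex.ofReal_mul, Complex.ofReal_re,
      Complex.ofReal_re, Finset.sum_mul_sum, Finset.sum_mul]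
    refine Finset.sum_congr rfl fun i _ => ?_
    rw [Finset.sum_mul]
    refine Finset.sum_congr rfl fun j _ => ?_
    rw [Finset.mul_sum]
    refine Finset.sum_congr rfl fun m _ => ?_
    ring
  have hi : ∀ i j m, Integrable (fun ψ : Metric.sphere (0 : 𝔼) 1 => a i * b j * c m *
      (‖⟪ψ.1, x i⟫‖ ^ 2 * ‖⟪ψ.1, y j⟫‖ ^ 2 * ‖⟪ψ.1, z m⟫‖ ^ 2)) (haarPureState d) :=
    fun i j m => integrable_haarPureState (f := fun ψ => a i * b j * c m *
      (‖⟪ψ, x i⟫‖ ^ 2 * ‖⟪ψ, y j⟫‖ ^ 2 * ‖⟪ψ, z m⟫‖ ^ 2)) (by fun_prop)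
  simp_rw [h]
  rw [integral_finsetSum _ fun i _ => integrable_finsetSum _ fun j _ =>
    integrable_finsetSum _ fun m _ => hi i j m]
  refine Finset.sum_congr rfl fun i _ => ?_
  rw [integral_finsetSum _ fun j _ => integrable_finsetSum _ fun m _ => hi i j m]
  refine Finset.sum_congr rfl fun j _ => ?_
  rw [integral_finsetSum _ fun m _ => hi i j m, Finset.mul_sum]
  refine Finset.sum_congr rfl fun m _ => ?_
  rw [integral_const_mul, integral_haarPureState hd]
  ring

variable {ι : Type*} [Fintype ι]

lemma POVM.isHermitian (A : POVM (Fin d) ι) (j : ι) : (A.elem j).IsHermitian :=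
  (A.posSemidef j).isHermitian

/-- The eigenvalues of the elements of a POVM, as weights of its rank one refinement. -/
noncomputable def POVM.weight (A : POVM (Fin d) ι) (k : ι × Fin d) : ℝ :=
  (A.isHermitian k.1).eigenvalues k.2

/-- The eigenvectors of the elements of a POVM, as vectors of its rank one refinement. -/
noncomputable def POVM.vec (A : POVM (Fin d) ι) (k : ι × Fin d) : 𝔼 :=
  (A.isHermitian k.1).eigenvectorBasis k.2

lemma POVM.weight_nonneg (A : POVM (Fin d) ι) (k) : 0 ≤ A.weight k :=
  (A.posSemidef k.1).eigenvalues_nonneg k.2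

lemma POVM.norm_vec (A : POVM (Fin d) ι) (k) : ‖A.vec k‖ = 1 :=
  (A.isHermitian k.1).eigenvectorBasis.norm_eq_one k.2

lemma POVM.sum_weight_smul_ketbra_vec (A : POVM (Fin d) ι) (j : ι) :
    ∑ i, (A.weight (j, i) : ℂ) • ketbra (A.vec (j, i)) = A.elem j :=
  (A.isHermitian j).sum_eigenvalues_smul_ketbra

lemma POVM.sum_refinement (A : POVM (Fin d) ι) :
    ∑ k, (A.weight k : ℂ) • ketbra (A.vec k) = 1 := by
  rw [Fintype.sum_prod_type, ← A.sum_eq_one]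
  exact Finset.sum_congr rfl fun j _ => A.sum_weight_smul_ketbra_vec j

/-- Elements and estimators are all expanded in eigenvectors. The eigenvalues of an estimator are a
probability distribution, so a mixed estimator does no better than the pointwise bound
`gramPerm_le`. -/
lemma averageFidelity_tensor_le (hd : 1 ≤ d) (A : POVM (Fin d) ι)
    {est : ι × ι → Matrix (Fin d) (Fin d) ℂ} (hest : ∀ j, IsDensityOperator (est j)) :
    averageFidelity (A.tensor A) est ≤
      2 * ((d : ℝ) ^ 2 + d + ∑ k, ∑ l, A.weight k * A.weight l * ‖⟪A.vec k, A.vec l⟫‖) /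
        (d * (d + 1) * (d + 2)) := by
  have h1 : ∀ j k, ∫ ψ : Metric.sphere (0 : 𝔼) 1,
      ((ketbra ψ.1 ⊗ₖ ketbra ψ.1) * (A.tensor A).elem (j, k)).trace.re *
        (ketbra ψ.1 * est (j, k)).trace.re ∂haarPureState d ≤
      ∑ i, ∑ i', A.weight (j, i) * A.weight (k, i') *
        (2 * (1 + ‖⟪A.vec (j, i), A.vec (k, i')⟫‖ + ‖⟪A.vec (j, i), A.vec (k, i')⟫‖ ^ 2)) /
          (d * (d + 1) * (d + 2)) := by
    intro j k
    obtain ⟨hpos, htr⟩ := hest (j, k)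
    have hH := hpos.isHermitian
    have hsum : ∑ m, hH.eigenvalues m = 1 := by
      have := hH.trace_eq_sum_eigenvalues
      rw [htr, ← RCLike.ofReal_sum] at this
      exact Complex.ofReal_injective (by simpa using this.symm)
    have h2 := integral_outcome hd (fun i => A.weight (j, i)) (fun i => A.weight (k, i))
      hH.eigenvalues (fun i => A.vec (j, i)) (fun i => A.vec (k, i)) hH.eigenvectorBasis
    rw [A.sum_weight_smul_ketbra_vec, A.sum_weight_smul_ketbra_vec,
      hH.sum_eigenvalues_smul_ketbra] at h2
    refine h2.trans_le (Finset.sum_le_sum fun i _ => Finset.sum_le_sum fun i' _ => ?_)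
    rw [mul_div_assoc]
    refine mul_le_mul_of_nonneg_left ?_ (mul_nonneg (A.weight_nonneg _) (A.weight_nonneg _))
    calc _ ≤ ∑ m, hH.eigenvalues m *
          (2 * (1 + ‖⟪A.vec (j, i), A.vec (k, i')⟫‖ + ‖⟪A.vec (j, i), A.vec (k, i')⟫‖ ^ 2) /
            (d * (d + 1) * (d + 2))) := by
          refine Finset.sum_le_sum fun m _ => mul_le_mul_of_nonneg_left ?_
            (hpos.eigenvalues_nonneg m)
          gcongr
          exact gramPerm_le (A.norm_vec _) (A.norm_vec _) (hH.eigenvectorBasis.norm_eq_one m)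
      _ = _ := by rw [← Finset.sum_mul, hsum, one_mul]
  unfold averageFidelity
  rw [← sum_overlap_quadratic A.norm_vec A.sum_refinement, Fintype.sum_prod_type]
  refine (Finset.sum_le_sum fun j _ => Finset.sum_le_sum fun k _ => h1 j k).trans_eq ?_
  simp only [Fintype.sum_prod_type, Finset.sum_div]
  exact Finset.sum_congr rfl fun j _ => Finset.sum_comm

lemma estimationFidelity_tensor_le (hd : 1 ≤ d) (A : POVM (Fin d) ι) :
    estimationFidelity (A.tensor A) ≤
      2 * ((d : ℝ) ^ 2 + d + ∑ k, ∑ l, A.weight k * A.weight l * ‖⟪A.vec k, A.vec l⟫‖) /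
        (d * (d + 1) * (d + 2)) := by
  refine Real.sSup_le ?_ ?_
  · rintro _ ⟨est, hest, rfl⟩
    exact averageFidelity_tensor_le hd A hest
  -- `Real.sSup_le` also asks for a nonnegative bound, since the real supremum of the empty set is
  -- `0`.
  · have : 0 ≤ ∑ k, ∑ l, A.weight k * A.weight l * ‖⟪A.vec k, A.vec l⟫‖ :=
      Finset.sum_nonneg fun k _ => Finset.sum_nonneg fun l _ =>
        mul_nonneg (mul_nonneg (A.weight_nonneg k) (A.weight_nonneg l)) (norm_nonneg _)
    positivity

lemma averageFidelity_le_estimationFidelity (hd : 1 ≤ d) (A : POVM (Fin d) ι)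
    {est : ι × ι → Matrix (Fin d) (Fin d) ℂ} (hest : ∀ j, IsDensityOperator (est j)) :
    averageFidelity (A.tensor A) est ≤ estimationFidelity (A.tensor A) := by
  have hb : BddAbove {f : ℝ | ∃ est : ι × ι → Matrix (Fin d) (Fin d) ℂ,
      (∀ j, IsDensityOperator (est j)) ∧ f = averageFidelity (A.tensor A) est} := by
    exact ⟨_, fun f ⟨est, hest, hf⟩ => hf.trans_le (averageFidelity_tensor_le hd A hest)⟩
  exact le_csSup hb ⟨est, hest, rfl⟩

lemma isDensityOperator_ketbra {z : 𝔼} (hz : ‖z‖ = 1) : IsDensityOperator (ketbra z) :=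
  ⟨posSemidef_ketbra z, by rw [trace_ketbra, hz]; simp⟩

/-- Optimal estimators attain the bound for measurements of rank one. -/
lemma le_estimationFidelity_of_rankOne (hd : 1 ≤ d) (A : POVM (Fin d) ι) {w : ι → ℝ} {x : ι → 𝔼}
    (hx : ∀ j, ‖x j‖ = 1) (hA : ∀ j, A.elem j = (w j : ℂ) • ketbra (x j)) :
    2 * ((d : ℝ) ^ 2 + d + ∑ k, ∑ l, w k * w l * ‖⟪x k, x l⟫‖) / (d * (d + 1) * (d + 2)) ≤
      estimationFidelity (A.tensor A) := by
  have hsum : ∑ k, (w k : ℂ) • ketbra (x k) = 1 := by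
    rw [← A.sum_eq_one]; simp only [hA]
  choose z hz hzeq using fun p : ι × ι => exists_gramPerm_eq (hx p.1) (hx p.2)
  refine le_of_eq_of_le ?_ (averageFidelity_le_estimationFidelity hd A
    (est := fun p => ketbra (z p)) fun p => isDensityOperator_ketbra (hz p))
  rw [← sum_overlap_quadratic hx hsum, averageFidelity, Fintype.sum_prod_type]
  simp only [Finset.sum_div]
  refine Finset.sum_congr rfl fun j _ => Finset.sum_congr rfl fun k _ => ?_
  -- Each element and the estimator have rank one, hence expansions over `Unit`.
  have h := integral_outcome hd (fun _ : Unit => w j) (fun _ : Unit => w k) (fun _ : Unit => 1)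
    (fun _ => x j) (fun _ => x k) (fun _ => z (j, k))
  simp only [Finset.univ_unique, Finset.sum_singleton, Complex.ofReal_one, one_smul, one_mul,
    ← hA] at h
  rw [← hzeq (j, k), mul_div_assoc]
  exact h.symm

end Fidelity

/-! ### The bound and the case of equality -/

section Equality

variable {d : ℕ} {ι : Type*} [Fintype ι]

local notation "𝔼" => EuclideanSpace ℂ (Fin d)
local notation "⟪" x ", " y "⟫" => inner ℂ x y

lemma F2iid_eq (d : ℕ) : F2iid d =
    2 * ((d : ℝ) ^ 2 + d + (1 + (d - 1) / (Real.sqrt (d + 1))⁻¹)) /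
      (d * (d + 1) * (d + 2)) := by
  rw [F2iid, div_inv_eq_mul]; ring

lemma inv_sqrt_sq_mul (d : ℕ) : ((Real.sqrt (d + 1))⁻¹) ^ 2 * ((d : ℝ) + 1) = 1 := by
  have : (d + 1 : ℝ) ≠ 0 := by positivity
  rw [inv_pow, Real.sq_sqrt (by positivity), inv_mul_cancel₀ this]

lemma inv_sqrt_pos (d : ℕ) : 0 < (Real.sqrt ((d : ℝ) + 1))⁻¹ := by positivity

theorem estimationFidelity_tensor_le_F2iid (hd : 1 ≤ d) (A : POVM (Fin d) ι) :
    estimationFidelity (A.tensor A) ≤ F2iid d := by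
  refine (estimationFidelity_tensor_le hd A).trans ?_
  rw [F2iid_eq]
  gcongr
  exact sum_overlap_le A.weight_nonneg A.norm_vec A.sum_refinement (inv_sqrt_pos d)
    (inv_sqrt_sq_mul d)

theorem POVM.IsSIC.estimationFidelity_eq (hd : 1 ≤ d) {A : POVM (Fin d) ι} (h : A.IsSIC) :
    estimationFidelity (A.tensor A) = F2iid d := by
  refine le_antisymm (estimationFidelity_tensor_le_F2iid hd A) ?_
  obtain ⟨hcard, x, hx, hinner, hA⟩ := h
  refine le_of_eq_of_le ?_ (le_estimationFidelity_of_rankOne hd A (w := fun _ => 1 / (d : ℝ)) hx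
    (by simpa using hA))
  rw [F2iid_eq]
  congr 3
  set s := (Real.sqrt ((d : ℝ) + 1))⁻¹ with hs
  have hs0 : 0 < s := inv_sqrt_pos d
  have hsd : s ^ 2 * ((d : ℝ) + 1) = 1 := inv_sqrt_sq_mul d
  have hd0 : (d : ℝ) ≠ 0 := by positivity
  have hd1 : (d + 1 : ℝ) ≠ 0 := by positivity
  classical
  -- The overlap sum is then `(d⁴ s + d² (1 - s)) / d² = 1 + (d² - 1) s`, which is `1 + (d - 1) /
  -- s`.
  have h1 : ∀ k l, ‖⟪x k, x l⟫‖ = s + if k = l then 1 - s else 0 := by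
    intro k l
    split_ifs with hkl
    · subst hkl
      simp [hx]
    · rw [add_zero, ← sq_eq_sq₀ (norm_nonneg _) hs0.le, hinner k l hkl, div_eq_iff hd1, hsd]
  simp only [h1, mul_add, Finset.sum_add_distrib, Finset.sum_const, Finset.card_univ, hcard,
    mul_ite, mul_zero, Finset.sum_ite_eq, Finset.mem_univ, if_true, nsmul_eq_mul]
  push_cast
  have : (d : ℝ) = 1 / s ^ 2 - 1 := by
    field_simp; linarith
  field_simp
  linear_combination (-(d : ℝ) + 1) * hsd

/-- Weighted equiangular lines with the right angle that resolve the identity form a SIC. -/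
lemma isSIC_of_equiangular (hd : 1 ≤ d) {A : POVM (Fin d) ι} {w : ι → ℝ} {x : ι → 𝔼}
    (hx : ∀ j, ‖x j‖ = 1) (hA : ∀ j, A.elem j = (w j : ℂ) • ketbra (x j)) {s : ℝ}
    (hsd : s ^ 2 * ((d : ℝ) + 1) = 1) (h : ∀ j k, j ≠ k → ‖⟪x j, x k⟫‖ = s) : A.IsSIC := by
  have hsum : ∑ k, (w k : ℂ) • ketbra (x k) = 1 := by
    rw [← A.sum_eq_one]; simp only [hA]
  have hd0 : (d : ℝ) ≠ 0 := by positivity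
  have hd1 : (d + 1 : ℝ) ≠ 0 := by positivity
  have hw : ∀ j, w j = 1 / d := by
    classical
    intro j
    have h1 : ∀ k, w k * ‖⟪x j, x k⟫‖ ^ 2 =
        w k * s ^ 2 + if k = j then w k * (1 - s ^ 2) else 0 := by
      intro k
      split_ifs with hkj
      · subst hkj
        simp [hx]
        ring
      · rw [h j k (Ne.symm hkj), add_zero]
    -- Testing the resolution of the identity on `x j` gives `d s² + w j (1 - s²) = 1`; as `1 - s² =
    -- d s²`, this determines `w j`. The trace then counts the outcomes.
    have h2 := sum_weight_mul_normSq_inner hsum (x j)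
    simp only [h1, Finset.sum_add_distrib, ← Finset.sum_mul, sum_weight hx hsum, hx,
      Finset.sum_ite_eq', Finset.mem_univ, if_true] at h2
    rw [eq_div_iff hd0]
    have h3 : s ^ 2 ≠ 0 := by
      intro h0; rw [h0] at hsd; simp at hsd
    refine mul_left_cancel₀ h3 ?_
    linear_combination h2 - (1 - w j) * hsd
  refine ⟨?_, x, hx, fun j k hjk => ?_, fun j => ?_⟩
  · have := sum_weight hx hsum
    simp only [hw, Finset.sum_const, Finset.card_univ, nsmul_eq_mul] at this
    field_simp at this
    exact_mod_cast this
  · rw [h j k hjk, eq_div_iff hd1, hsd]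
  · rw [hA, hw]; simp

lemma POVM.IsSimple.elem_ne_zero (hd : 1 ≤ d) {A : POVM (Fin d) ι} (h : A.IsSimple) (j : ι) :
    A.elem j ≠ 0 := by
  by_cases hj : ∃ k, j ≠ k
  · obtain ⟨k, hk⟩ := hj
    exact (h j k hk).ne_zero 0
  -- With a single outcome simplicity is vacuous, but that element is the identity.
  · push Not at hj
    have : Nonempty (Fin d) := ⟨⟨0, hd⟩⟩
    have h1 := A.sum_eq_one
    rw [Fintype.sum_eq_single j fun k hk => absurd (hj k).symm hk] at h1
    rw [h1]
    exact one_ne_zero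

lemma not_linearIndependent_of_overlap_eq_one {x y : 𝔼} (hx : ‖x‖ = 1) (hy : ‖y‖ = 1)
    (h : ‖⟪x, y⟫‖ = 1) (a b : ℂ) : ¬ LinearIndependent ℂ ![a • ketbra x, b • ketbra y] := by
  intro hli
  have hx0 : x ≠ 0 := by rintro rfl; simp at hx
  have hy0 : y ≠ 0 := by rintro rfl; simp at hy
  obtain ⟨r, hr, rfl⟩ := (norm_inner_eq_norm_iff hx0 hy0).1 (by rw [h, hx, hy, one_mul])
  have hk : ketbra (r • x) = (r * star r) • ketbra x := by
    ext i j
    simp [ketbra, Matrix.vecMulVec_apply]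
    ring
  have ha : a ≠ 0 := by
    rintro rfl
    exact hli.ne_zero 0 (by simp)
  have := (LinearIndependent.pair_iff.1 hli (b * (r * star r)) (-a) (by
    rw [hk, smul_smul, smul_smul, smul_smul, ← add_smul]
    convert zero_smul ℂ (ketbra x)
    ring)).2
  exact ha (neg_eq_zero.1 this)

theorem POVM.IsSimple.isSIC (hd : 1 ≤ d) {A : POVM (Fin d) ι} (h : A.IsSimple)
    (hF : estimationFidelity (A.tensor A) = F2iid d) : A.IsSIC := by
  set s := (Real.sqrt ((d : ℝ) + 1))⁻¹ with hs
  have hs0 : 0 < s := inv_sqrt_pos d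
  have hsd : s ^ 2 * ((d : ℝ) + 1) = 1 := inv_sqrt_sq_mul d
  have hle := sum_overlap_le A.weight_nonneg A.norm_vec A.sum_refinement hs0 hsd
  have heq : ∑ k, ∑ l, A.weight k * A.weight l * ‖⟪A.vec k, A.vec l⟫‖ = 1 + (d - 1) / s := by
    refine le_antisymm hle ?_
    have h1 := estimationFidelity_tensor_le hd A
    rw [hF, F2iid_eq, div_le_div_iff_of_pos_right (by positivity)] at h1
    linarith
  have hov := @overlap_eq_of_sum_overlap_eq _ _ _ _ _ A.weight_nonneg A.norm_vec A.sum_refinement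
    _ hs0 hsd heq
  have hpos : ∀ j, ∃ i, 0 < A.weight (j, i) := by
    intro j
    by_contra! hj
    refine h.elem_ne_zero hd j ?_
    rw [← A.sum_weight_smul_ketbra_vec]
    refine Finset.sum_eq_zero fun i _ => ?_
    rw [le_antisymm (hj i) (A.weight_nonneg _)]
    simp
  choose i hi using hpos
  have hA : ∀ j, A.elem j = (A.weight (j, i j) : ℂ) • ketbra (A.vec (j, i j)) := by
    intro j
    rw [← A.sum_weight_smul_ketbra_vec]
    refine Fintype.sum_eq_single _ fun i' hi' => ?_
    have hw : A.weight (j, i') = 0 := by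
      by_contra hne
      -- A second positive eigenvalue would give overlap `0`, which is neither `s` nor `1`; so
      -- `A.elem j` has rank one.
      have horth : ⟪A.vec (j, i'), A.vec (j, i j)⟫ = 0 :=
        (A.isHermitian j).eigenvectorBasis.orthonormal.2 hi'
      have := hov ((A.weight_nonneg _).lt_of_ne' hne) (hi j)
      rw [horth, norm_zero] at this
      rcases this with h0 | h0
      · exact hs0.ne h0
      · exact zero_ne_one h0
    rw [hw]; simp
  refine isSIC_of_equiangular hd (fun j => A.norm_vec _) hA hsd fun j k hjk => ?_
  refine (hov (hi j) (hi k)).resolve_right fun h1 => ?_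
  have := h j k hjk
  rw [hA, hA] at this
  exact not_linearIndependent_of_overlap_eq_one (A.norm_vec _) (A.norm_vec _) h1 _ _ this

end Equality

theorem corollary3 {d : ℕ} (hd : 1 ≤ d) {ι : Type*} [Fintype ι] (A : POVM (Fin d) ι) :
    estimationFidelity (A.tensor A) ≤ F2iid d ∧
    (A.IsSimple → (estimationFidelity (A.tensor A) = F2iid d ↔ A.IsSIC)) :=
  ⟨estimationFidelity_tensor_le_F2iid hd A,
    fun h => ⟨h.isSIC hd, fun hS => hS.estimationFidelity_eq hd⟩⟩
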